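/- **Model.** A *one-clean-qubit protocol* is a two-party quantum communication protocol on $m+1$ qubits ($m$ arbitrary) that starts in the state $|0\rangle\langle 0|\otimes I/2^m$, the qubits being divided in a fixed way between Alice (input $x$) and Bob (input $y$). In each round one player applies to the qubits held by that player a unitary that may depend on the round and on that player's input, and then sends some of these qubits (a choice that may depend on the round, but not on the inputs) to the other player. At the end a single two-outcome projective measurement (accept/reject), not depending on the inputs, is made by one player on the qubits this player holds. The communication is the total number of qubits sent. A *classical randomized protocol* is a public-coin protocol, i.e. a probability distribution on deterministic protocol trees; its communication is the number of bits sent in the worst case over inputs and coins. If a quantum protocol $\mathcal P$ for $f:X\times Y\to\{0,1\}$ accepts all $1$-inputs of $f$ with probability at least $\alpha$ and all $0$-inputs with probability at most $\beta$, then a *classical simulation of $\mathcal P$ with additive error $\epsilon$* (with respect to $f$, $\alpha$, $\beta$) is a classical randomized protocol that accepts all $1$-inputs with probability at least $\alpha-\epsilon$ and all $0$-inputs with probability at most $\beta+\epsilon$. **Theorem.** There are functions $f_n:\{0,1\}^n\times\{0,1\}^n\to\{0,1\}$, with $f_n=\mathrm{MIDDLE}_n$ for all even $n$, where $\mathrm{MIDDLE}_n(x,y)=0$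 if $\sum_{i=1}^n x_iy_i=n/2$ and $\mathrm{MIDDLE}_n(x,y)=1$ otherwise; one-clean-qubit protocols $\mathcal P_n$ with communication $O(\log n)$; and real numbers $\beta_n<\alpha_n$ such that $\mathcal P_n$ accepts every $1$-input of $f_n$ with probability at least $\alpha_n$ and every $0$-input of $f_n$ with probability at most $\beta_n$, and such that the classical simulation of $\mathcal P_n$ with additive error $1/n^4$ requires $\Theta(n)$ communication. That is, there are constants $c>0$ and $C$ such that for all sufficiently large $n$: 1. every classical simulation of $\mathcal P_n$ with additive error $1/n^4$ (with respect to $f_n,\alpha_n,\beta_n$) has communication at least $cn$; 2. there is a classical simulation of $\mathcal P_n$ with additive error $1/n^4$ that has communication at most $Cn$, and it can be chosen so that on every input its acceptance probability differs from that of $\mathcal P_n$ by at most $1/n^4$. -/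

import Mathlib

open Filter

/-! ## Quantum protocols in which only one qubit is initially clean -/

/-- The operator `V ⊗ I` on the qubits `ι`: `V` acts on the qubits in `S` and the identity acts on
all other qubits. Computational basis states are bit assignments `ι → Bool`. -/
def onQubits {ι : Type} [Fintype ι] [DecidableEq ι] (S : Finset ι)
    (V : Matrix ({i // i ∈ S} → Bool) ({i // i ∈ S} → Bool) ℂ) :
    Matrix (ι → Bool) (ι → Bool) ℂ :=
  Matrix.of fun a b =>
    if ∀ i, i ∉ S → a i = b i then V (fun i => a i.1) (fun i => b i.1) else 0

/-- A (clocked) two-player quantum protocol on the qubits `ι`, to be run when Alice (input in `X`)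
holds the qubits in the index `A` and Bob (input in `Y`) holds those in `Aᶜ`.
In every round the speaking player applies a unitary, which may depend on the round and on that
player's input, to the qubits that player holds, and then sends some of these qubits (which ones may
depend on the round, not on the inputs) to the other player. The protocol ends with one
projective measurement, independent of the inputs, made by one of the players on the qubits this
player holds; the outcome of the projection `E` means `accept`. A final local unitary is a round in
which no qubit is sent. -/
inductive QuantumProtocol (X Y ι : Type) [Fintype ι] [DecidableEq ι] : Finset ι → Type
  | aliceMeasures {A : Finset ι} (E : Matrix ({i // i ∈ A} → Bool) ({i // i ∈ A} → Bool) ℂ)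
      (hermitian : E.IsHermitian) (idempotent : E * E = E) : QuantumProtocol X Y ι A
  | bobMeasures {A : Finset ι} (E : Matrix ({i // i ∈ Aᶜ} → Bool) ({i // i ∈ Aᶜ} → Bool) ℂ)
      (hermitian : E.IsHermitian) (idempotent : E * E = E) : QuantumProtocol X Y ι A
  | aliceSends {A : Finset ι} (U : X → Matrix.unitaryGroup ({i // i ∈ A} → Bool) ℂ)
      (S : Finset ι) (held : S ⊆ A) (next : QuantumProtocol X Y ι (A \ S)) :
      QuantumProtocol X Y ι A
  | bobSends {A : Finset ι} (U : Y → Matrix.unitaryGroup ({i // i ∈ Aᶜ} → Bool) ℂ)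
      (S : Finset ι) (held : S ⊆ Aᶜ) (next : QuantumProtocol X Y ι (A ∪ S)) :
      QuantumProtocol X Y ι A

namespace QuantumProtocol

variable {X Y ι : Type} [Fintype ι] [DecidableEq ι]

/-- The total number of qubits sent. -/
def communication : {A : Finset ι} → QuantumProtocol X Y ι A → ℕ
  | _, aliceMeasures _ _ _ => 0
  | _, bobMeasures _ _ _ => 0
  | _, aliceSends _ S _ next => S.card + next.communication
  | _, bobSends _ S _ next => S.card + next.communication

/-- The probability of acceptance on inputs `x`, `y` when the protocol starts in the global state
with density matrix `ρ`. (The trace is a real number whenever `ρ` is a density matrix.) -/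
noncomputable def acceptProb (x : X) (y : Y) :
    {A : Finset ι} → QuantumProtocol X Y ι A → Matrix (ι → Bool) (ι → Bool) ℂ → ℝ
  | A, aliceMeasures E _ _, ρ => (onQubits A E * ρ).trace.re
  | A, bobMeasures E _ _, ρ => (onQubits Aᶜ E * ρ).trace.re
  | A, aliceSends U _ _ next, ρ =>
      next.acceptProb x y (onQubits A (U x).1 * ρ * (onQubits A (U x).1).conjTranspose)
  | A, bobSends U _ _ next, ρ =>
      next.acceptProb x y (onQubits Aᶜ (U y).1 * ρ * (onQubits Aᶜ (U y).1).conjTranspose)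

end QuantumProtocol

/-- The density matrix `|0⟩⟨0| ⊗ I / 2 ^ m`: qubit `0` is clean, the other `m` qubits are totally
mixed. -/
noncomputable def oneCleanQubitState (m : ℕ) :
    Matrix (Fin (m + 1) → Bool) (Fin (m + 1) → Bool) ℂ :=
  Matrix.diagonal fun b => if b 0 = false then 1 / 2 ^ m else 0

/-- A one-clean-qubit protocol: one clean qubit, any number of totally mixed qubits, any initial
division of the qubits between the players. -/
structure OneCleanQubitProtocol (X Y : Type) where
  /-- the number of totally mixed qubits -/
  mixed : ℕ
  /-- the qubits that Alice holds at the start -/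
  aliceStart : Finset (Fin (mixed + 1))
  protocol : QuantumProtocol X Y (Fin (mixed + 1)) aliceStart

namespace OneCleanQubitProtocol

variable {X Y : Type}

def communication (P : OneCleanQubitProtocol X Y) : ℕ := P.protocol.communication

noncomputable def acceptProb (P : OneCleanQubitProtocol X Y) (x : X) (y : Y) : ℝ :=
  P.protocol.acceptProb x y (oneCleanQubitState P.mixed)

end OneCleanQubitProtocol

/-! ## Classical randomized protocols -/

/-- Deterministic protocol trees: at an inner node the designated player sends one bit, depending on
that player's input; a leaf carries the output. -/
inductive ProtocolTree (X Y : Type) : Type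
  | output (b : Bool) : ProtocolTree X Y
  | alice (bit : X → Bool) (ifFalse ifTrue : ProtocolTree X Y) : ProtocolTree X Y
  | bob (bit : Y → Bool) (ifFalse ifTrue : ProtocolTree X Y) : ProtocolTree X Y

namespace ProtocolTree

variable {X Y : Type}

/-- The number of bits sent in the worst case. -/
def depth : ProtocolTree X Y → ℕ
  | output _ => 0
  | alice _ l r => max l.depth r.depth + 1
  | bob _ l r => max l.depth r.depth + 1

def eval (x : X) (y : Y) : ProtocolTree X Y → Bool
  | output b => b
  | alice bit l r => if bit x then r.eval x y else l.eval x y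
  | bob bit l r => if bit y then r.eval x y else l.eval x y

end ProtocolTree

/-- A public-coin randomized protocol: a probability distribution on deterministic protocols. -/
abbrev RandomizedProtocol (X Y : Type) : Type := PMF (ProtocolTree X Y)

namespace RandomizedProtocol

variable {X Y : Type}

/-- At most `d` bits are sent, for all inputs and all outcomes of the coins. -/
def CommunicationAtMost (R : RandomizedProtocol X Y) (d : ℕ) : Prop :=
  ∀ t ∈ R.support, t.depth ≤ d

noncomputable def acceptProb (R : RandomizedProtocol X Y) (x : X) (y : Y) : ℝ :=
  (PMF.map (fun t => t.eval x y) R true).toReal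

end RandomizedProtocol

/-! ## Thresholds, simulation, and the function -/

/-- `1`-inputs of `f` are accepted with probability at least `α` and `0`-inputs with probability at
most `β`, where `p x y` is the probability of acceptance. -/
def AcceptsWith {X Y : Type} (p : X → Y → ℝ) (f : X → Y → Bool) (α β : ℝ) : Prop :=
  (∀ x y, f x y = true → α ≤ p x y) ∧ (∀ x y, f x y = false → p x y ≤ β)

/-- `R` is a classical simulation, with additive error `ε`, of a quantum protocol for `f` that
accepts `1`-inputs with probability at least `α` and `0`-inputs with probability at most `β`. -/
def RandomizedProtocol.Simulates {X Y : Type} (R : RandomizedProtocol X Y) (f : X → Y → Bool)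
    (α β ε : ℝ) : Prop :=
  AcceptsWith R.acceptProb f (α - ε) (β + ε)

/-- `MIDDLE(x, y) = 0` if `∑ xᵢ yᵢ = n / 2` and `MIDDLE(x, y) = 1` otherwise. -/
def middle (n : ℕ) (x y : Fin n → Bool) : Bool :=
  decide (((∑ i, (x i).toNat * (y i).toNat : ℕ) : ℚ) ≠ (n : ℚ) / 2)

/-!
The function tests whether the overlap `∑ xᵢ yᵢ` equals `k = ⌊n / 2⌋`.

*Quantum protocol.* Let `N = 2 ^ r` be the first power of two above `n`, and let `u` be the uniform
superposition of the basis states of `r` qubits. Attaching the sign `(-1) ^ (xⱼ yⱼ)` to the basis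
state `j`, after padding the inputs to length `N`, makes the inner product with `u` equal to
`2 (k - ∑ xᵢ yᵢ) / N`. On `r + 1` qubits with a final projection of rank one, a totally mixed register
costs only a factor `2 ^ (-r)` in comparison with a pure initial state, because a unitary can turn the
projection onto "the clean qubit is `0`" into one whose only eigenvector of eigenvalue `1` among the
states with clean qubit `0` is `u`. So `O(log n)` qubits give acceptance probability
`4 (k - ∑ xᵢ yᵢ) ^ 2 / N ^ 3`, which is exactly `0` on `0`-inputs and at least `4 / N ^ 3`, of order
`n ^ (-3)`, on `1`-inputs (`middleProtocol_acceptProb`).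

*Upper bound.* The acceptance probability is an integer over `N ^ 3`. With a public random number below
`N ^ 3`, Alice sends `x` and Bob answers (`exists_simulation_middleProtocol`).

*Lower bound.* A simulation with error `n ^ (-4)` accepts `0`-inputs with probability at most
`n ^ (-4)`, smaller than its acceptance probability on `1`-inputs by a factor of order `n`. Fixing
`k - 1` common ones, it accepts disjoint pairs of sets with much higher probability than pairs with
exactly one common point. Deterministic protocols of depth `d` consist of `2 ^ d` rectangles, so this is
excluded by a corruption bound (`disjointWeight_le`): up to an exponentially small error, the weight of
disjoint pairs in a rectangle `𝒜 × ℬ` is at most a constant times the weight of pairs with exactly one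
common point. For the corruption bound, pick a random `W`, and consider the members of `𝒜` within `W`
and those of `ℬ` within the complement. If a point `i ∈ W` lies in at least a quarter of the former, and
likewise for `ℬ` with the complement enlarged by `i`, then pairs through `i` alone are plentiful. Points
for which this fails are few, since a family in which linearly many points are rare is exponentially
small (`card_membersWithin_le_of_rare`), and typical members of `𝒜` omit many more points of `W` than
that (`le_sum_card_membersWithin_erase`).
-/

/-! ### Corruption for unique disjointness -/

section Corruption

variable {ι : Type} [DecidableEq ι]

/-- The members of the family `𝒜` that are contained in `W`. -/
def membersWithin (𝒜 : Finset (Finset ι)) (W : Finset ι) : Finset (Finset ι) :=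
  𝒜.filter fun a => a ⊆ W

/-- The members of the family `𝒜` that are contained in `W` and contain the point `i`. -/
def membersWithinThrough (𝒜 : Finset (Finset ι)) (W : Finset ι) (i : ι) : Finset (Finset ι) :=
  𝒜.filter fun a => a ⊆ W ∧ i ∈ a

lemma membersWithin_subset_powerset (𝒜 : Finset (Finset ι)) (W : Finset ι) :
    membersWithin 𝒜 W ⊆ W.powerset := by
  intro a ha
  simpa using (Finset.mem_filter.1 ha).2

lemma card_membersWithin_le (𝒜 : Finset (Finset ι)) (W : Finset ι) :
    ((membersWithin 𝒜 W).card : ℝ) ≤ 2 ^ W.card := by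
  have := Finset.card_le_card (membersWithin_subset_powerset 𝒜 W)
  rw [Finset.card_powerset] at this
  exact_mod_cast this

lemma membersWithin_mono (𝒜 : Finset (Finset ι)) {V W : Finset ι} (h : V ⊆ W) :
    membersWithin 𝒜 V ⊆ membersWithin 𝒜 W :=
  Finset.monotone_filter_right _ fun _ _ ha => ha.trans h

lemma sum_powerset_half_pow_card_inter {S W : Finset ι} (h : S ⊆ W) :
    ∑ a ∈ W.powerset, (1 / 2 : ℝ) ^ (a ∩ S).card = 2 ^ W.card * (3 / 4) ^ S.card := by
  have h1 := Finset.prod_add (fun i => if i ∈ S then (1 / 2 : ℝ) else 1) (fun _ => 1) W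
  have h2 : ∀ a : Finset ι, ∏ i ∈ a, (if i ∈ S then (1 / 2 : ℝ) else 1)
      = (1 / 2 : ℝ) ^ (a ∩ S).card := by
    intro a
    rw [Finset.prod_ite_mem, Finset.prod_const]
  simp only [h2, Finset.prod_const_one, mul_one] at h1
  rw [← h1]
  have h3 : ∀ i ∈ W, ((if i ∈ S then (1 / 2 : ℝ) else 1) + 1)
      = 2 * (if i ∈ S then (3 / 4 : ℝ) else 1) := by
    intro i _
    split_ifs <;> norm_num
  rw [Finset.prod_congr rfl h3, Finset.prod_mul_distrib, Finset.prod_const, Finset.prod_ite_mem,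
    Finset.prod_const, Finset.inter_eq_right.2 h]

/-- A family on `W` in which each of `4 * q` points lies in at most a quarter of the members is
exponentially small: its members meet these points in `q` elements on average, which is atypical for
subsets of `W`. -/
lemma card_membersWithin_le_of_rare (𝒜 : Finset (Finset ι)) {S W : Finset ι} (h : S ⊆ W) {q : ℕ}
    (hS : S.card = 4 * q)
    (rare : ∀ i ∈ S, 4 * (membersWithinThrough 𝒜 W i).card ≤ (membersWithin 𝒜 W).card) :
    ((membersWithin 𝒜 W).card : ℝ) ≤ (81 / 128) ^ q * 2 ^ W.card := by
  have hdc : ∑ a ∈ membersWithin 𝒜 W, (a ∩ S).card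
      = ∑ i ∈ S, (membersWithinThrough 𝒜 W i).card := by
    have := Finset.sum_card_bipartiteAbove_eq_sum_card_bipartiteBelow
      (s := membersWithin 𝒜 W) (t := S) (fun (a : Finset ι) (i : ι) => i ∈ a)
    simp only [Finset.bipartiteAbove, Finset.bipartiteBelow] at this
    rw [Finset.sum_congr rfl fun a _ => by rw [Finset.inter_comm, ← Finset.filter_mem_eq_inter],
      this]
    refine Finset.sum_congr rfl fun i _ => ?_
    rw [membersWithin, membersWithinThrough, Finset.filter_filter]
  have havg : ∑ a ∈ membersWithin 𝒜 W, (a ∩ S).card ≤ q * (membersWithin 𝒜 W).card := by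
    have h4 := Finset.sum_le_sum rare
    rw [← Finset.mul_sum, ← hdc, Finset.sum_const, hS, smul_eq_mul] at h4
    nlinarith
  have havg' : ∑ a ∈ membersWithin 𝒜 W, ((a ∩ S).card : ℝ)
      ≤ q * (membersWithin 𝒜 W).card := by exact_mod_cast havg
  -- a tangent-line form of the convexity of `x ↦ 2⁻ˣ`
  have hpt : ∀ x : ℕ, (1 / 2 : ℝ) ^ q * (1 + q - x) ≤ (1 / 2) ^ x := by
    intro x
    rcases le_total x q with hx | hx
    · obtain ⟨j, rfl⟩ := Nat.exists_eq_add_of_le hx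
      have hj : (1 + (j : ℝ) * 1) ≤ (1 + 1) ^ j :=
        one_add_mul_le_pow (by norm_num) j
      have h5 : (1 / 2 : ℝ) ^ j * (1 + 1) ^ j = 1 := by
        rw [← mul_pow]; norm_num
      have h6 : (0 : ℝ) < (1 / 2) ^ j := by positivity
      have h7 : (0 : ℝ) < (1 / 2) ^ x := by positivity
      have h8 : (1 / 2 : ℝ) ^ j * (1 + j) ≤ 1 := by
        have := mul_le_mul_of_nonneg_left hj h6.le
        rwa [h5, mul_one] at this
      rw [pow_add]
      push_cast
      nlinarith
    · rcases hx.eq_or_lt with rfl | hx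
      · simp
      · have h5 : ((q : ℝ) + 1) ≤ x := by exact_mod_cast hx
        have h6 : (0 : ℝ) < (1 / 2) ^ q := by positivity
        have h7 : (0 : ℝ) < (1 / 2) ^ x := by positivity
        nlinarith
  have hlow : (1 / 2 : ℝ) ^ q * (membersWithin 𝒜 W).card
      ≤ ∑ a ∈ membersWithin 𝒜 W, (1 / 2 : ℝ) ^ (a ∩ S).card := by
    refine le_trans ?_ (Finset.sum_le_sum fun a _ => hpt (a ∩ S).card)
    rw [← Finset.mul_sum, Finset.sum_sub_distrib, Finset.sum_const, nsmul_eq_mul]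
    refine mul_le_mul_of_nonneg_left ?_ (by positivity)
    linarith
  have hup : ∑ a ∈ membersWithin 𝒜 W, (1 / 2 : ℝ) ^ (a ∩ S).card
      ≤ 2 ^ W.card * (3 / 4) ^ (4 * q) := by
    rw [← hS, ← sum_powerset_half_pow_card_inter h]
    exact Finset.sum_le_sum_of_subset_of_nonneg (membersWithin_subset_powerset 𝒜 W)
      fun _ _ _ => by positivity
  have hq : (81 / 128 : ℝ) ^ q = 2 ^ q * (3 / 4) ^ (4 * q) := by
    rw [pow_mul, ← mul_pow]; norm_num
  have h2 : (2 : ℝ) ^ q * (1 / 2) ^ q = 1 := by rw [← mul_pow]; norm_num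
  calc ((membersWithin 𝒜 W).card : ℝ)
      = 2 ^ q * ((1 / 2) ^ q * (membersWithin 𝒜 W).card) := by rw [← mul_assoc, h2, one_mul]
    _ ≤ 2 ^ q * (2 ^ W.card * (3 / 4) ^ (4 * q)) :=
        mul_le_mul_of_nonneg_left (hlow.trans hup) (by positivity)
    _ = _ := by rw [hq]; ring

/-- The points of `W` that lie in less than a quarter of the members of `𝒜` within `W`. -/
def rarePoints (𝒜 : Finset (Finset ι)) (W : Finset ι) : Finset ι :=
  W.filter fun i => 4 * (membersWithinThrough 𝒜 W i).card < (membersWithin 𝒜 W).card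

lemma rarePoints_subset (𝒜 : Finset (Finset ι)) (W : Finset ι) : rarePoints 𝒜 W ⊆ W :=
  Finset.filter_subset _ _

lemma card_rarePoints_mul_le (𝒜 : Finset (Finset ι)) (W : Finset ι) (q : ℕ) :
    ((rarePoints 𝒜 W).card : ℝ) * (membersWithin 𝒜 W).card
      ≤ 4 * q * (membersWithin 𝒜 W).card + W.card * ((81 / 128) ^ q * 2 ^ W.card) := by
  rcases le_total (rarePoints 𝒜 W).card (4 * q) with h | h
  · have h' : ((rarePoints 𝒜 W).card : ℝ) ≤ 4 * q := by exact_mod_cast h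
    have := mul_le_mul_of_nonneg_right h' (Nat.cast_nonneg (α := ℝ) (membersWithin 𝒜 W).card)
    have h0 : (0 : ℝ) ≤ W.card * ((81 / 128) ^ q * 2 ^ W.card) := by positivity
    linarith
  · obtain ⟨S, hS, hc⟩ := Finset.exists_subset_card_eq h
    have h1 := card_membersWithin_le_of_rare 𝒜 (hS.trans (Finset.filter_subset _ _)) hc
      fun i hi => (Finset.mem_filter.1 (hS hi)).2.le
    have h2 : ((rarePoints 𝒜 W).card : ℝ) ≤ W.card := by
      exact_mod_cast Finset.card_le_card (Finset.filter_subset _ _)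
    have h3 := mul_le_mul h2 h1 (by positivity) (by positivity)
    have h0 : (0 : ℝ) ≤ 4 * q * (membersWithin 𝒜 W).card := by positivity
    linarith

/-- Most subsets of `W` omit at least `t` points of `W`, so that deleting one point of `W` loses
little on average. -/
lemma le_sum_card_membersWithin_erase (𝒜 : Finset (Finset ι)) (W : Finset ι) (t : ℕ) :
    (t : ℝ) * (membersWithin 𝒜 W).card - t * 2 ^ t * (3 / 2) ^ W.card
      ≤ ∑ i ∈ W, ((membersWithin 𝒜 (W.erase i)).card : ℝ) := by
  have hdc : ∑ a ∈ membersWithin 𝒜 W, (W \ a).card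
      = ∑ i ∈ W, (membersWithin 𝒜 (W.erase i)).card := by
    have := Finset.sum_card_bipartiteAbove_eq_sum_card_bipartiteBelow
      (s := membersWithin 𝒜 W) (t := W) (fun (a : Finset ι) (i : ι) => i ∉ a)
    simp only [Finset.bipartiteAbove, Finset.bipartiteBelow] at this
    rw [Finset.sum_congr rfl fun a _ => by rw [Finset.sdiff_eq_filter], this]
    refine Finset.sum_congr rfl fun i _ => ?_
    rw [membersWithin, membersWithin, Finset.filter_filter]
    congr 1
    refine Finset.filter_congr fun a _ => ?_
    rw [Finset.subset_erase]
  have hpt : ∀ x : ℕ, (t : ℝ) - t * 2 ^ t * (1 / 2) ^ x ≤ x := by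
    intro x
    rcases le_total t x with hx | hx
    · have h1 : (t : ℝ) ≤ x := by exact_mod_cast hx
      have h2 : (0 : ℝ) ≤ t * 2 ^ t * (1 / 2) ^ x := by positivity
      linarith
    · obtain ⟨j, rfl⟩ := Nat.exists_eq_add_of_le hx
      have h2 : (2 : ℝ) ^ (x + j) * (1 / 2) ^ x = 2 ^ j := by
        rw [pow_add, mul_right_comm, ← mul_pow]; norm_num
      rw [mul_assoc, h2]
      have h3 : (1 : ℝ) ≤ 2 ^ j := one_le_pow₀ (by norm_num)
      have h4 : (0 : ℝ) ≤ ((x + j : ℕ) : ℝ) := by positivity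
      have h5 : (0 : ℝ) ≤ (x : ℝ) := by positivity
      nlinarith
  have hsum : ∑ a ∈ membersWithin 𝒜 W, (1 / 2 : ℝ) ^ (W \ a).card ≤ (3 / 2) ^ W.card := by
    refine le_trans (Finset.sum_le_sum_of_subset_of_nonneg (membersWithin_subset_powerset 𝒜 W)
      fun _ _ _ => by positivity) ?_
    have := Finset.sum_pow_mul_eq_add_pow (1 : ℝ) (1 / 2) W
    rw [show (3 / 2 : ℝ) = 1 + 1 / 2 by norm_num, ← this]
    refine Finset.sum_le_sum fun a ha => ?_
    rw [one_pow, one_mul, Finset.card_sdiff_of_subset (Finset.mem_powerset.1 ha)]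
  have hcast : ∑ i ∈ W, ((membersWithin 𝒜 (W.erase i)).card : ℝ)
      = ∑ a ∈ membersWithin 𝒜 W, ((W \ a).card : ℝ) := by exact_mod_cast hdc.symm
  rw [hcast]
  refine le_trans ?_ (Finset.sum_le_sum fun a _ => hpt (W \ a).card)
  rw [Finset.sum_sub_distrib, Finset.sum_const, nsmul_eq_mul, ← Finset.mul_sum]
  have : (t : ℝ) * 2 ^ t * ∑ a ∈ membersWithin 𝒜 W, (1 / 2 : ℝ) ^ (W \ a).card
      ≤ t * 2 ^ t * (3 / 2) ^ W.card := mul_le_mul_of_nonneg_left hsum (by positivity)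
  linarith

variable [Fintype ι]

/-- The pairs `(W, i)` with `i ∈ W` correspond to the pairs `(insert i Wᶜ, i)`. -/
lemma sum_insert_compl {M : Type} [AddCommMonoid M] (h : Finset ι → ι → M) :
    ∑ W : Finset ι, ∑ i ∈ W, h (insert i Wᶜ) i = ∑ W : Finset ι, ∑ i ∈ W, h W i := by
  rw [Finset.sum_sigma', Finset.sum_sigma']
  have inv : ∀ (W : Finset ι) (i : ι), i ∈ W → insert i (insert i Wᶜ)ᶜ = W := by
    intro W i hi
    ext j
    by_cases hj : j = i <;> simp [hj, hi]
  refine Finset.sum_nbij' (fun p => ⟨insert p.2 p.1ᶜ, p.2⟩) (fun p => ⟨insert p.2 p.1ᶜ, p.2⟩)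
    ?_ ?_ ?_ ?_ ?_
  · rintro ⟨W, i⟩ _; simp
  · rintro ⟨W, i⟩ _; simp
  · rintro ⟨W, i⟩ h; simp only [inv W i (by simpa using h)]
  · rintro ⟨W, i⟩ h; simp only [inv W i (by simpa using h)]
  · rintro ⟨W, i⟩ _; rfl

/-- The weight of the disjoint pairs in the rectangle `𝒜 × ℬ`: a disjoint pair `(a, b)` is counted
once for each `W` with `a ⊆ W` and `b ⊆ Wᶜ`. -/
def disjointWeight (𝒜 ℬ : Finset (Finset ι)) : ℝ :=
  ∑ W : Finset ι, ((membersWithin 𝒜 W).card : ℝ) * (membersWithin ℬ Wᶜ).card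

/-- The weight of the pairs in the rectangle `𝒜 × ℬ` with exactly one common point `i`: such a pair
`(a, b)` is counted once for each `W ∋ i` with `a ⊆ W` and `b ⊆ insert i Wᶜ`. -/
def uniqueWeight (𝒜 ℬ : Finset (Finset ι)) : ℝ :=
  ∑ W : Finset ι, ∑ i ∈ W, ((membersWithinThrough 𝒜 W i).card : ℝ)
    * (membersWithinThrough ℬ (insert i Wᶜ) i).card

/-- The contribution of the pairs `(W, i)` in which `i` is rare for `𝒜`: there are few such `i` unless
`𝒜` has very few members within `W`. -/
lemma sum_rare_mul_le (𝒜 ℬ : Finset (Finset ι)) (q : ℕ) :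
    ∑ W : Finset ι, ∑ i ∈ W, (if i ∈ rarePoints 𝒜 W then
        ((membersWithin 𝒜 W).card : ℝ) * (membersWithin ℬ Wᶜ).card else 0)
      ≤ 4 * q * disjointWeight 𝒜 ℬ
        + Fintype.card ι * (81 / 128) ^ q * 4 ^ Fintype.card ι := by
  have key : ∀ W : Finset ι, ∑ i ∈ W, (if i ∈ rarePoints 𝒜 W then
        ((membersWithin 𝒜 W).card : ℝ) * (membersWithin ℬ Wᶜ).card else 0)
      ≤ 4 * q * (((membersWithin 𝒜 W).card : ℝ) * (membersWithin ℬ Wᶜ).card)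
        + Fintype.card ι * (81 / 128) ^ q * 2 ^ Fintype.card ι := by
    intro W
    rw [Finset.sum_ite_mem, Finset.inter_eq_right.2 (rarePoints_subset 𝒜 W),
      Finset.sum_const, nsmul_eq_mul, ← mul_assoc]
    have h1 := card_rarePoints_mul_le 𝒜 W q
    have h2 := card_membersWithin_le ℬ Wᶜ
    have h3 : (W.card : ℝ) ≤ Fintype.card ι := by exact_mod_cast Finset.card_le_univ W
    have h4 : (2 : ℝ) ^ W.card * 2 ^ Wᶜ.card = 2 ^ Fintype.card ι := by
      rw [← pow_add, Finset.card_add_card_compl]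
    refine (mul_le_mul_of_nonneg_right h1 (Nat.cast_nonneg _)).trans ?_
    rw [add_mul]
    refine add_le_add (le_of_eq (by ring)) ?_
    calc (W.card : ℝ) * ((81 / 128) ^ q * 2 ^ W.card) * (membersWithin ℬ Wᶜ).card
        ≤ (Fintype.card ι : ℝ) * ((81 / 128) ^ q * 2 ^ W.card) * 2 ^ Wᶜ.card := by gcongr
      _ = _ := by rw [← h4]; ring
  refine (Finset.sum_le_sum fun W _ => key W).trans ?_
  rw [Finset.sum_add_distrib, ← Finset.mul_sum, Finset.sum_const, Finset.card_univ,
    Fintype.card_finset, nsmul_eq_mul, disjointWeight,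
    show (4 : ℝ) = 2 * 2 by norm_num, mul_pow]
  refine add_le_add le_rfl (le_of_eq ?_)
  push_cast
  ring

lemma disjointWeight_comm (𝒜 ℬ : Finset (Finset ι)) :
    disjointWeight ℬ 𝒜 = disjointWeight 𝒜 ℬ := by
  rw [disjointWeight, disjointWeight, ← Equiv.sum_comp (compl_involutive (α := Finset ι)).toPerm]
  refine Finset.sum_congr rfl fun W _ => ?_
  simp [mul_comm]

/-- Corruption: a rectangle that is not exponentially small and contains many disjoint pairs also
contains many pairs with exactly one common point. -/
theorem disjointWeight_le (𝒜 ℬ : Finset (Finset ι)) (q : ℕ) :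
    8 * q * disjointWeight 𝒜 ℬ ≤ 16 * uniqueWeight 𝒜 ℬ
      + (2 * Fintype.card ι * (81 / 128) ^ q
        + 16 * q * 2 ^ (16 * q) * (7 / 8) ^ Fintype.card ι) * 4 ^ Fintype.card ι := by
  have hlow : 16 * q * disjointWeight 𝒜 ℬ
        - 16 * q * 2 ^ (16 * q) * (7 / 8) ^ Fintype.card ι * 4 ^ Fintype.card ι
      ≤ ∑ W : Finset ι, ∑ i ∈ W,
        ((membersWithin 𝒜 (W.erase i)).card : ℝ) * (membersWithin ℬ Wᶜ).card := by
    have hsum : ∑ W : Finset ι, (3 / 2 : ℝ) ^ W.card * 2 ^ Wᶜ.card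
        = (7 / 8) ^ Fintype.card ι * 4 ^ Fintype.card ι := by
      rw [← mul_pow, show (7 / 8 * 4 : ℝ) = 3 / 2 + 2 by norm_num,
        ← Fintype.sum_pow_mul_eq_add_pow]
      simp only [Finset.card_compl]
    rw [mul_assoc _ ((7 / 8 : ℝ) ^ _), ← hsum, disjointWeight, Finset.mul_sum, Finset.mul_sum,
      ← Finset.sum_sub_distrib]
    refine Finset.sum_le_sum fun W _ => ?_
    rw [← Finset.sum_mul]
    have h1 := le_sum_card_membersWithin_erase 𝒜 W (16 * q)
    have h2 := card_membersWithin_le ℬ Wᶜ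
    refine le_trans ?_ (mul_le_mul_of_nonneg_right h1 (Nat.cast_nonneg _))
    rw [sub_mul]
    push_cast
    have h3 : 16 * (q : ℝ) * 2 ^ (16 * q) * (3 / 2) ^ W.card * (membersWithin ℬ Wᶜ).card
        ≤ 16 * (q : ℝ) * 2 ^ (16 * q) * (3 / 2) ^ W.card * 2 ^ Wᶜ.card := by gcongr
    linarith
  have hup : ∑ W : Finset ι, ∑ i ∈ W,
        ((membersWithin 𝒜 (W.erase i)).card : ℝ) * (membersWithin ℬ Wᶜ).card
      ≤ 16 * uniqueWeight 𝒜 ℬ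
        + (4 * q * disjointWeight 𝒜 ℬ + Fintype.card ι * (81 / 128) ^ q * 4 ^ Fintype.card ι)
        + (4 * q * disjointWeight 𝒜 ℬ
          + Fintype.card ι * (81 / 128) ^ q * 4 ^ Fintype.card ι) := by
    have hA := sum_rare_mul_le 𝒜 ℬ q
    have hB := sum_rare_mul_le ℬ 𝒜 q
    rw [disjointWeight_comm, ← sum_insert_compl] at hB
    refine le_trans ?_ (add_le_add (add_le_add le_rfl hA) hB)
    -- the pair `(W, i)` goes to the second or third term if `i` is rare for `𝒜` or for `ℬ`, and to
    -- the first term otherwise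
    rw [uniqueWeight, Finset.mul_sum, ← Finset.sum_add_distrib, ← Finset.sum_add_distrib]
    refine Finset.sum_le_sum fun W _ => ?_
    rw [Finset.mul_sum, ← Finset.sum_add_distrib, ← Finset.sum_add_distrib]
    refine Finset.sum_le_sum fun i hi => ?_
    have hc : (insert i Wᶜ)ᶜ = W.erase i := by
      ext j; simp [Finset.mem_erase]
    rw [hc]
    have hAm : ((membersWithin 𝒜 (W.erase i)).card : ℝ) ≤ (membersWithin 𝒜 W).card := by
      exact_mod_cast Finset.card_le_card (membersWithin_mono 𝒜 (Finset.erase_subset _ _))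
    have hBm : ((membersWithin ℬ Wᶜ).card : ℝ) ≤ (membersWithin ℬ (insert i Wᶜ)).card := by
      exact_mod_cast Finset.card_le_card (membersWithin_mono ℬ (Finset.subset_insert _ _))
    have hU : (0 : ℝ) ≤ 16 * (((membersWithinThrough 𝒜 W i).card : ℝ)
        * (membersWithinThrough ℬ (insert i Wᶜ) i).card) := by positivity
    by_cases ha : i ∈ rarePoints 𝒜 W
    · rw [if_pos ha]
      have h1 := mul_le_mul_of_nonneg_right hAm
        (Nat.cast_nonneg (α := ℝ) (membersWithin ℬ Wᶜ).card)
      have h2 : (0 : ℝ) ≤ if i ∈ rarePoints ℬ (insert i Wᶜ) then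
        ((membersWithin ℬ (insert i Wᶜ)).card : ℝ) * (membersWithin 𝒜 (W.erase i)).card
          else 0 := by split_ifs <;> positivity
      linarith
    · rw [if_neg ha]
      by_cases hb : i ∈ rarePoints ℬ (insert i Wᶜ)
      · rw [if_pos hb]
        have h1 := mul_le_mul_of_nonneg_left hBm
          (Nat.cast_nonneg (α := ℝ) (membersWithin 𝒜 (W.erase i)).card)
        linarith
      · rw [if_neg hb]
        have ha' : (membersWithin 𝒜 W).card ≤ 4 * (membersWithinThrough 𝒜 W i).card := by
          by_contra hcon
          exact ha (Finset.mem_filter.2 ⟨hi, not_le.1 hcon⟩)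
        have hb' : (membersWithin ℬ (insert i Wᶜ)).card
            ≤ 4 * (membersWithinThrough ℬ (insert i Wᶜ) i).card := by
          by_contra hcon
          exact hb (Finset.mem_filter.2 ⟨Finset.mem_insert_self _ _, not_le.1 hcon⟩)
        have ha'' : ((membersWithin 𝒜 W).card : ℝ) ≤ 4 * (membersWithinThrough 𝒜 W i).card := by
          exact_mod_cast ha'
        have hb'' : ((membersWithin ℬ (insert i Wᶜ)).card : ℝ)
            ≤ 4 * (membersWithinThrough ℬ (insert i Wᶜ) i).card := by exact_mod_cast hb'
        have := mul_le_mul (hAm.trans ha'') (hBm.trans hb'') (by positivity) (by positivity)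
        linarith
  linarith

end Corruption

/-! ### Randomized protocols and rectangles -/

section Rectangles

variable {X Y P Q : Type}

/-- A deterministic protocol of depth `d` splits every rectangle into at most `2 ^ d` rectangles with
constant output, so a weight that is at most `e` on rectangles is at most `2 ^ d * e` on the accepted
inputs. -/
lemma ProtocolTree.sum_eval_le (c : P → Q → ℝ) (φ : P → X) (ψ : Q → Y) {e : ℝ} (he : 0 ≤ e)
    (hc : ∀ (𝒜 : Finset P) (ℬ : Finset Q), ∑ a ∈ 𝒜, ∑ b ∈ ℬ, c a b ≤ e) (t : ProtocolTree X Y) :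
    ∀ (𝒜 : Finset P) (ℬ : Finset Q),
      ∑ a ∈ 𝒜, ∑ b ∈ ℬ, c a b * (if t.eval (φ a) (ψ b) then 1 else 0) ≤ 2 ^ t.depth * e := by
  have split : ∀ (l r : ProtocolTree X Y) (u v : ℝ), u ≤ 2 ^ l.depth * e → v ≤ 2 ^ r.depth * e →
      u + v ≤ 2 ^ (max l.depth r.depth + 1) * e := by
    intro l r u v hu hv
    have h1 : (2 : ℝ) ^ l.depth * e ≤ 2 ^ max l.depth r.depth * e :=
      mul_le_mul_of_nonneg_right (pow_le_pow_right₀ (by norm_num) (le_max_left _ _)) he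
    have h2 : (2 : ℝ) ^ r.depth * e ≤ 2 ^ max l.depth r.depth * e :=
      mul_le_mul_of_nonneg_right (pow_le_pow_right₀ (by norm_num) (le_max_right _ _)) he
    rw [pow_succ]
    linarith
  induction t with
  | output o =>
    intro 𝒜 ℬ
    cases o
    · simpa [ProtocolTree.eval, ProtocolTree.depth] using he
    · simpa [ProtocolTree.eval, ProtocolTree.depth] using hc 𝒜 ℬ
  | alice bit l r hl hr =>
    intro 𝒜 ℬ
    rw [← Finset.sum_filter_add_sum_filter_not 𝒜 (fun a => bit (φ a) = true), add_comm]
    refine split l r _ _ ((Finset.sum_congr rfl fun a ha => ?_).trans_le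
      (hl (𝒜.filter fun a => ¬bit (φ a) = true) ℬ)) ((Finset.sum_congr rfl fun a ha => ?_).trans_le
      (hr (𝒜.filter fun a => bit (φ a) = true) ℬ))
    · simp only [ProtocolTree.eval, if_neg (Finset.mem_filter.1 ha).2]
    · simp only [ProtocolTree.eval, if_pos (Finset.mem_filter.1 ha).2]
  | bob bit l r hl hr =>
    intro 𝒜 ℬ
    simp only [← Finset.sum_filter_add_sum_filter_not ℬ (fun b => bit (ψ b) = true)]
    rw [Finset.sum_add_distrib, add_comm]
    refine split l r _ _
      ((Finset.sum_congr rfl fun a _ => Finset.sum_congr rfl fun b hb => ?_).trans_le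
      (hl 𝒜 (ℬ.filter fun b => ¬bit (ψ b) = true)))
      ((Finset.sum_congr rfl fun a _ => Finset.sum_congr rfl fun b hb => ?_).trans_le
      (hr 𝒜 (ℬ.filter fun b => bit (ψ b) = true)))
    · simp only [ProtocolTree.eval, if_neg (Finset.mem_filter.1 hb).2]
    · simp only [ProtocolTree.eval, if_pos (Finset.mem_filter.1 hb).2]

lemma RandomizedProtocol.acceptProb_eq_tsum (R : RandomizedProtocol X Y) (x : X) (y : Y) :
    R.acceptProb x y = ∑' t, (R t).toReal * (if t.eval x y then 1 else 0) := by
  rw [RandomizedProtocol.acceptProb, PMF.map_apply, ENNReal.tsum_toReal_eq]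
  · refine tsum_congr fun t => ?_
    cases t.eval x y <;> simp
  · intro t
    split_ifs
    · exact R.apply_ne_top t
    · simp

lemma PMF.summable_toReal {α : Type} (p : PMF α) : Summable fun a => (p a).toReal :=
  ENNReal.summable_toReal p.tsum_coe_ne_top

lemma PMF.tsum_toReal {α : Type} (p : PMF α) : ∑' a, (p a).toReal = 1 := by
  rw [← ENNReal.tsum_toReal_eq p.apply_ne_top, p.tsum_coe, ENNReal.toReal_one]

lemma RandomizedProtocol.sum_acceptProb_le [Fintype P] [Fintype Q] (c : P → Q → ℝ)
    (φ : P → X) (ψ : Q → Y) {e : ℝ} (he : 0 ≤ e) (hc : ∀ (𝒜 : Finset P) (ℬ : Finset Q), ∑ a ∈ 𝒜, ∑ b ∈ ℬ, c a b ≤ e)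
    (R : RandomizedProtocol X Y) {d : ℕ} (hd : R.CommunicationAtMost d) :
    ∑ a, ∑ b, c a b * R.acceptProb (φ a) (ψ b) ≤ 2 ^ d * e := by
  have hs : ∀ a b, Summable fun t =>
      (R t).toReal * (if t.eval (φ a) (ψ b) then (1 : ℝ) else 0) := fun a b =>
    R.summable_toReal.of_nonneg_of_le (fun t => by positivity) fun t => by
      split_ifs <;> simp
  have hs' : ∀ a b, Summable fun t =>
      c a b * ((R t).toReal * (if t.eval (φ a) (ψ b) then (1 : ℝ) else 0)) := fun a b =>
    (hs a b).mul_left _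
  have hswap : ∑ a, ∑ b, c a b * R.acceptProb (φ a) (ψ b)
      = ∑' t, ∑ a, ∑ b, c a b * ((R t).toReal * (if t.eval (φ a) (ψ b) then (1 : ℝ) else 0)) := by
    rw [Summable.tsum_finsetSum fun a _ => summable_sum fun b _ => hs' a b]
    refine Finset.sum_congr rfl fun a _ => ?_
    rw [Summable.tsum_finsetSum fun b _ => hs' a b]
    refine Finset.sum_congr rfl fun b _ => ?_
    rw [tsum_mul_left, R.acceptProb_eq_tsum]
  have hone : (2 : ℝ) ^ d * e = ∑' t, (R t).toReal * (2 ^ d * e) := by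
    rw [tsum_mul_right, R.tsum_toReal, one_mul]
  rw [hswap, hone]
  refine Summable.tsum_le_tsum (fun t => ?_)
    (summable_sum fun a _ => summable_sum fun b _ => hs' a b) (R.summable_toReal.mul_right _)
  have hfac : ∑ a, ∑ b, c a b * ((R t).toReal * (if t.eval (φ a) (ψ b) then (1 : ℝ) else 0))
      = (R t).toReal * ∑ a, ∑ b, c a b * (if t.eval (φ a) (ψ b) then (1 : ℝ) else 0) := by
    simp only [Finset.mul_sum]
    exact Finset.sum_congr rfl fun a _ => Finset.sum_congr rfl fun b _ => by ring
  rw [hfac]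
  by_cases ht : t ∈ R.support
  · refine mul_le_mul_of_nonneg_left ?_ ENNReal.toReal_nonneg
    refine (t.sum_eval_le c φ ψ he hc Finset.univ Finset.univ).trans ?_
    exact mul_le_mul_of_nonneg_right (pow_le_pow_right₀ (by norm_num) (hd t ht)) he
  · rw [PMF.mem_support_iff, not_not] at ht
    simp [ht]

end Rectangles

/-! ### Randomized protocols that separate disjoint from uniquely intersecting pairs -/

section SeparatingProtocols

variable {ι : Type} [DecidableEq ι] [Fintype ι]

lemma card_membersWithin_univ (W : Finset ι) :
    ((membersWithin Finset.univ W).card : ℝ) = 2 ^ W.card := by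
  have : membersWithin Finset.univ W = W.powerset := by ext; simp [membersWithin]
  rw [this, Finset.card_powerset]
  norm_cast

lemma disjointWeight_univ :
    disjointWeight (Finset.univ : Finset (Finset ι)) Finset.univ = 4 ^ Fintype.card ι := by
  have : ∀ W : Finset ι, (2 : ℝ) ^ W.card * 2 ^ Wᶜ.card = 2 ^ Fintype.card ι := by
    intro W
    rw [← pow_add, Finset.card_add_card_compl]
  simp only [disjointWeight, card_membersWithin_univ, this]
  rw [Finset.sum_const, Finset.card_univ, Fintype.card_finset, nsmul_eq_mul,
    show (4 : ℝ) = 2 * 2 by norm_num, mul_pow]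
  norm_cast

lemma uniqueWeight_univ_le :
    uniqueWeight (Finset.univ : Finset (Finset ι)) Finset.univ
      ≤ Fintype.card ι * 4 ^ Fintype.card ι := by
  have h1 : ∀ (W : Finset ι) (i : ι), i ∈ W →
      ((membersWithinThrough Finset.univ W i).card : ℝ)
        * (membersWithinThrough Finset.univ (insert i Wᶜ) i).card
      ≤ (membersWithin Finset.univ W).card * (membersWithin Finset.univ Wᶜ).card := by
    intro W i hi
    have hA : (membersWithinThrough Finset.univ W i).card ≤ (membersWithin Finset.univ W).card :=
      Finset.card_le_card (Finset.monotone_filter_right _ fun _ _ h => h.1)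
    have hB : (membersWithinThrough Finset.univ (insert i Wᶜ) i).card
        ≤ (membersWithin Finset.univ Wᶜ).card := by
      refine Finset.card_le_card_of_injOn (fun b => b.erase i) ?_ ?_
      · intro b hb
        have hb := (Finset.mem_filter.1 hb).2.1
        simpa [membersWithin] using Finset.subset_insert_iff.1 hb
      · intro b hb b' hb' h
        have hb := (Finset.mem_filter.1 hb).2.2
        have hb' := (Finset.mem_filter.1 hb').2.2
        simp only at h
        rw [← Finset.insert_erase hb, h, Finset.insert_erase hb']
    exact_mod_cast Nat.mul_le_mul hA hB
  rw [← disjointWeight_univ, uniqueWeight, disjointWeight, Finset.mul_sum]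
  refine Finset.sum_le_sum fun W _ => ?_
  refine (Finset.sum_le_sum fun i hi => h1 W i hi).trans ?_
  rw [Finset.sum_const, nsmul_eq_mul]
  have : (W.card : ℝ) ≤ Fintype.card ι := by exact_mod_cast Finset.card_le_univ W
  exact mul_le_mul_of_nonneg_right this (by positivity)

/-- The number of times `disjointWeight` counts the pair `(a, b)`. -/
def disjointCount (a b : Finset ι) : ℝ :=
  ∑ W : Finset ι, (if a ⊆ W then 1 else 0) * (if b ⊆ Wᶜ then 1 else 0)

/-- The number of times `uniqueWeight` counts the pair `(a, b)`. -/
def uniqueCount (a b : Finset ι) : ℝ :=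
  ∑ W : Finset ι, ∑ i ∈ W, (if a ⊆ W ∧ i ∈ a then 1 else 0)
    * (if b ⊆ insert i Wᶜ ∧ i ∈ b then 1 else 0)

lemma sum_disjointCount (𝒜 ℬ : Finset (Finset ι)) :
    ∑ a ∈ 𝒜, ∑ b ∈ ℬ, disjointCount a b = disjointWeight 𝒜 ℬ := by
  simp only [disjointCount, disjointWeight, membersWithin, Finset.card_filter, Nat.cast_sum,
    Nat.cast_ite, Nat.cast_one, Nat.cast_zero, Finset.sum_mul_sum]
  exact (Finset.sum_congr rfl fun a _ => Finset.sum_comm).trans Finset.sum_comm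

lemma sum_uniqueCount (𝒜 ℬ : Finset (Finset ι)) :
    ∑ a ∈ 𝒜, ∑ b ∈ ℬ, uniqueCount a b = uniqueWeight 𝒜 ℬ := by
  simp only [uniqueCount, uniqueWeight, membersWithinThrough, Finset.card_filter, Nat.cast_sum,
    Nat.cast_ite, Nat.cast_one, Nat.cast_zero, Finset.sum_mul_sum]
  simp only [Finset.sum_comm (s := ℬ)]
  rw [Finset.sum_comm]
  refine Finset.sum_congr rfl fun W _ => ?_
  rw [Finset.sum_comm]

lemma disjointCount_mul_le {a b : Finset ι} {γ p : ℝ} (h : Disjoint a b → γ ≤ p) :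
    disjointCount a b * γ ≤ disjointCount a b * p := by
  rw [disjointCount, Finset.sum_mul, Finset.sum_mul]
  refine Finset.sum_le_sum fun W _ => ?_
  by_cases ha : a ⊆ W
  · by_cases hb : b ⊆ Wᶜ
    · have := h (Finset.disjoint_of_subset_left ha
        (Finset.disjoint_of_subset_right hb disjoint_compl_right))
      simpa [ha, hb] using this
    · simp [hb]
  · simp [ha]

lemma uniqueCount_mul_le {a b : Finset ι} {ε p : ℝ} (h : (∃ i, a ∩ b = {i}) → p ≤ ε) :
    uniqueCount a b * p ≤ uniqueCount a b * ε := by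
  simp only [uniqueCount, Finset.sum_mul]
  refine Finset.sum_le_sum fun W _ => Finset.sum_le_sum fun i _ => ?_
  by_cases ha : a ⊆ W ∧ i ∈ a
  · by_cases hb : b ⊆ insert i Wᶜ ∧ i ∈ b
    · have hab : a ∩ b = {i} := by
        ext j
        rw [Finset.mem_inter, Finset.mem_singleton]
        refine ⟨fun hj => ?_, fun hj => hj ▸ ⟨ha.2, hb.2⟩⟩
        rcases Finset.mem_insert.1 (hb.1 hj.2) with hji | hjW
        · exact hji
        · exact absurd (ha.1 hj.1) (Finset.mem_compl.1 hjW)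
      simpa [ha, hb] using h ⟨i, hab⟩
    · simp [hb]
  · simp [ha]

/-- A protocol that accepts all disjoint pairs with probability at least `γ` and all pairs with
exactly one common point with probability at most `ε` has linear communication unless `γ` is at most
a constant multiple of `ε`. -/
theorem RandomizedProtocol.le_of_separates_disjoint_unique {X Y : Type}
    (R : RandomizedProtocol X Y) {d : ℕ} (hd : R.CommunicationAtMost d)
    (φ : Finset ι → X) (ψ : Finset ι → Y) {γ ε : ℝ} (hε : 0 ≤ ε)
    (hdis : ∀ a b, Disjoint a b → γ ≤ R.acceptProb (φ a) (ψ b))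
    (huni : ∀ a b i, a ∩ b = {i} → R.acceptProb (φ a) (ψ b) ≤ ε) (q : ℕ) :
    8 * q * γ ≤ 16 * (Fintype.card ι * ε) + 2 ^ d * (2 * Fintype.card ι * (81 / 128) ^ q
        + 16 * q * 2 ^ (16 * q) * (7 / 8) ^ Fintype.card ι) := by
  have hmain := R.sum_acceptProb_le
    (fun a b : Finset ι => 8 * q * disjointCount a b - 16 * uniqueCount a b) φ ψ
    (e := (2 * Fintype.card ι * (81 / 128) ^ q
        + 16 * q * 2 ^ (16 * q) * (7 / 8) ^ Fintype.card ι) * 4 ^ Fintype.card ι)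
    (by positivity)
    (fun 𝒜 ℬ => by
      simp only [Finset.sum_sub_distrib, ← Finset.mul_sum, sum_disjointCount, sum_uniqueCount]
      linarith [disjointWeight_le 𝒜 ℬ q]) (d := d) hd
  have hlow : ∑ a : Finset ι, ∑ b : Finset ι, (8 * q * (disjointCount a b * γ)
        - 16 * (uniqueCount a b * ε))
      ≤ ∑ a, ∑ b, (8 * q * disjointCount a b - 16 * uniqueCount a b)
        * R.acceptProb (φ a) (ψ b) := by
    refine Finset.sum_le_sum fun a _ => Finset.sum_le_sum fun b _ => ?_
    have h1 := disjointCount_mul_le (hdis a b)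
    have h2 := uniqueCount_mul_le (p := R.acceptProb (φ a) (ψ b)) (ε := ε)
      fun ⟨i, hi⟩ => huni a b i hi
    have h3 := mul_le_mul_of_nonneg_left h1 (show (0 : ℝ) ≤ 8 * q by positivity)
    rw [sub_mul]
    linarith
  simp only [Finset.sum_sub_distrib, ← Finset.mul_sum, ← Finset.sum_mul, sum_disjointCount,
    sum_uniqueCount, disjointWeight_univ] at hlow
  have hu := mul_le_mul_of_nonneg_right (uniqueWeight_univ_le (ι := ι)) hε
  have h4 : (0 : ℝ) < 4 ^ Fintype.card ι := by positivity
  refine le_of_mul_le_mul_right ?_ h4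
  linarith

end SeparatingProtocols

/-! ### Operators on all qubits -/

section AllQubits

variable {ι β : Type} [Fintype ι] [DecidableEq ι]

/-- If `S` contains all qubits, the basis states of the qubits in `S` are those of the whole
system. -/
def restrictEquiv (S : Finset ι) (hS : ∀ i, i ∈ S) : ({i // i ∈ S} → Bool) ≃ (ι → Bool) :=
  Equiv.arrowCongr (Equiv.subtypeUnivEquiv hS) (Equiv.refl Bool)

/-- A matrix on `β` as an operator on the qubits in `S`, where `S` contains all qubits and `η` labels
the basis states by `β`. -/
def onAllQubits (S : Finset ι) (hS : ∀ i, i ∈ S) (η : (ι → Bool) ≃ β) (M : Matrix β β ℂ) :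
    Matrix ({i // i ∈ S} → Bool) ({i // i ∈ S} → Bool) ℂ :=
  M.submatrix ((restrictEquiv S hS).trans η) ((restrictEquiv S hS).trans η)

lemma onQubits_onAllQubits (S : Finset ι) (hS : ∀ i, i ∈ S) (η : (ι → Bool) ≃ β)
    (M : Matrix β β ℂ) : onQubits S (onAllQubits S hS η M) = M.submatrix η η := by
  ext a b
  simp only [onQubits, Matrix.of_apply, onAllQubits, Matrix.submatrix_apply]
  rw [if_pos fun i hi => absurd (hS i) hi]
  rfl

variable [Fintype β] [DecidableEq β]

/-- A unitary matrix on `β` as a unitary operator on the qubits in `S`. -/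
def unitaryOnAllQubits (S : Finset ι) (hS : ∀ i, i ∈ S) (η : (ι → Bool) ≃ β)
    (U : Matrix.unitaryGroup β ℂ) : Matrix.unitaryGroup ({i // i ∈ S} → Bool) ℂ :=
  ⟨onAllQubits S hS η U.1, by
    have h := Matrix.mem_unitaryGroup_iff.1 U.2
    rw [Matrix.star_eq_conjTranspose] at h
    rw [Matrix.mem_unitaryGroup_iff, Matrix.star_eq_conjTranspose, onAllQubits,
      Matrix.conjTranspose_submatrix, Matrix.submatrix_mul_equiv, h, Matrix.submatrix_one_equiv]⟩

/-- The protocol in which Alice, holding all qubits, applies `U` and sends all qubits to Bob, who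
applies `V` and sends all qubits back; Alice then applies `U'` and measures the projection `E`. -/
def roundTripProtocol {X Y : Type} (η : (ι → Bool) ≃ β) (U U' : X → Matrix.unitaryGroup β ℂ)
    (V : Y → Matrix.unitaryGroup β ℂ) (E : Matrix β β ℂ) (hE : E.IsHermitian) (hEE : E * E = E) :
    QuantumProtocol X Y ι Finset.univ :=
  .aliceSends (fun x => unitaryOnAllQubits _ Finset.mem_univ η (U x)) Finset.univ subset_rfl <|
  .bobSends (fun y => unitaryOnAllQubits _ (by simp) η (V y)) Finset.univ (by simp) <|
  .aliceSends (fun x => unitaryOnAllQubits _ (by simp) η (U' x)) ∅ (Finset.empty_subset _) <|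
  .aliceMeasures (onAllQubits _ (by simp) η E)
    (by rw [Matrix.IsHermitian, onAllQubits, Matrix.conjTranspose_submatrix, hE.eq])
    (by rw [onAllQubits, Matrix.submatrix_mul_equiv, hEE])

lemma roundTripProtocol_communication {X Y : Type} (η : (ι → Bool) ≃ β)
    (U U' : X → Matrix.unitaryGroup β ℂ) (V : Y → Matrix.unitaryGroup β ℂ) (E : Matrix β β ℂ)
    (hE : E.IsHermitian) (hEE : E * E = E) :
    (roundTripProtocol η U U' V E hE hEE).communication = 2 * Fintype.card ι := by
  simp only [roundTripProtocol, QuantumProtocol.communication, Finset.card_univ,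
    Finset.card_empty]
  ring

lemma roundTripProtocol_acceptProb {X Y : Type} (η : (ι → Bool) ≃ β)
    (U U' : X → Matrix.unitaryGroup β ℂ) (V : Y → Matrix.unitaryGroup β ℂ) (E : Matrix β β ℂ)
    (hE : E.IsHermitian) (hEE : E * E = E) (x : X) (y : Y) (ρ : Matrix β β ℂ) :
    (roundTripProtocol η U U' V E hE hEE).acceptProb x y (ρ.submatrix η η)
      = (E * ((U' x).1 * ((V y).1 * ((U x).1 * ρ * (U x).1.conjTranspose)
        * (V y).1.conjTranspose) * (U' x).1.conjTranspose)).trace.re := by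
  simp only [roundTripProtocol, QuantumProtocol.acceptProb, unitaryOnAllQubits,
    onQubits_onAllQubits, Matrix.conjTranspose_submatrix, Matrix.submatrix_mul_equiv]
  congr 1
  exact Equiv.sum_comp η (Matrix.diag (E * ((U' x).1 * ((V y).1 * ((U x).1 * ρ
    * (U x).1.conjTranspose) * (V y).1.conjTranspose) * (U' x).1.conjTranspose)))

end AllQubits

/-! ### Testing with one clean qubit whether signs cancel -/

section PhaseTest

variable {J : Type}

/-- The projection `|u⟩⟨u|` onto the uniform superposition `u` of the basis states in `J`. -/
noncomputable def uniformProjection (J : Type) [Fintype J] : Matrix J J ℂ :=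
  Matrix.of fun _ _ => (Fintype.card J : ℂ)⁻¹

lemma uniformProjection_conjTranspose [Fintype J] :
    (uniformProjection J).conjTranspose = uniformProjection J := by
  ext i j
  simp [uniformProjection]

lemma uniformProjection_mul_self [Fintype J] [Nonempty J] :
    uniformProjection J * uniformProjection J = uniformProjection J := by
  ext i j
  have : (Fintype.card J : ℂ) ≠ 0 := by exact_mod_cast Fintype.card_ne_zero
  simp [uniformProjection, Matrix.mul_apply, this]

/-- The operator that flips the clean qubit unless the register is in the state `u`. Basis states
with clean qubit `0` are on the left of `J ⊕ J`, those with clean qubit `1` on the right. -/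
noncomputable def flipUnlessUniform (J : Type) [Fintype J] [DecidableEq J] :
    Matrix (J ⊕ J) (J ⊕ J) ℂ :=
  Matrix.fromBlocks (uniformProjection J) (1 - uniformProjection J) (1 - uniformProjection J)
    (uniformProjection J)

/-- The operator that adds the bit `s j` to the clean qubit when the register is in the basis state
`j`. -/
def addBit [DecidableEq J] (s : J → Bool) : Matrix (J ⊕ J) (J ⊕ J) ℂ :=
  Matrix.fromBlocks (Matrix.diagonal fun j => if s j then 0 else 1)
    (Matrix.diagonal fun j => if s j then 1 else 0) (Matrix.diagonal fun j => if s j then 1 else 0)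
    (Matrix.diagonal fun j => if s j then 0 else 1)

/-- The operator that multiplies the basis state `j` with clean qubit `1` by `-1` if `t j` holds. -/
def controlledSign [DecidableEq J] (t : J → Bool) : Matrix (J ⊕ J) (J ⊕ J) ℂ :=
  Matrix.fromBlocks 1 0 0 (Matrix.diagonal fun j => if t j then -1 else 1)

lemma mem_unitaryGroup_of_involution {β : Type} [Fintype β] [DecidableEq β] {M : Matrix β β ℂ}
    (h : M.conjTranspose = M) (h' : M * M = 1) : M ∈ Matrix.unitaryGroup β ℂ := by
  rw [Matrix.mem_unitaryGroup_iff, Matrix.star_eq_conjTranspose, h, h']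

lemma flipUnlessUniform_conjTranspose [Fintype J] [DecidableEq J] :
    (flipUnlessUniform J).conjTranspose = flipUnlessUniform J := by
  simp [flipUnlessUniform, Matrix.fromBlocks_conjTranspose, uniformProjection_conjTranspose]

lemma flipUnlessUniform_mul_self [Fintype J] [DecidableEq J] [Nonempty J] :
    flipUnlessUniform J * flipUnlessUniform J = 1 := by
  have h := uniformProjection_mul_self (J := J)
  rw [flipUnlessUniform, Matrix.fromBlocks_multiply, ← Matrix.fromBlocks_one]
  congr 1 <;> simp only [sub_mul, mul_sub, h, one_mul, mul_one] <;> abel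

lemma addBit_conjTranspose [DecidableEq J] (s : J → Bool) : (addBit s).conjTranspose = addBit s := by
  simp only [addBit, Matrix.fromBlocks_conjTranspose, Matrix.diagonal_conjTranspose]
  congr 2 <;> ext j <;> simp only [Pi.star_apply] <;> split_ifs <;> simp

lemma addBit_mul_self [Fintype J] [DecidableEq J] (s : J → Bool) : addBit s * addBit s = 1 := by
  simp only [addBit, Matrix.fromBlocks_multiply, Matrix.diagonal_mul_diagonal,
    Matrix.diagonal_add]
  rw [← Matrix.fromBlocks_one, ← Matrix.diagonal_one, ← Matrix.diagonal_zero]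
  congr 2 <;> ext j <;> split_ifs <;> simp

lemma controlledSign_conjTranspose [DecidableEq J] (t : J → Bool) :
    (controlledSign t).conjTranspose = controlledSign t := by
  simp only [controlledSign, Matrix.fromBlocks_conjTranspose, Matrix.diagonal_conjTranspose,
    Matrix.conjTranspose_one, Matrix.conjTranspose_zero]
  congr 2
  ext j
  simp only [Pi.star_apply]
  split_ifs <;> simp

lemma controlledSign_mul_self [Fintype J] [DecidableEq J] (t : J → Bool) :
    controlledSign t * controlledSign t = 1 := by
  simp only [controlledSign, Matrix.fromBlocks_multiply, Matrix.diagonal_mul_diagonal]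
  rw [← Matrix.fromBlocks_one, ← Matrix.diagonal_one]
  congr 1
  · simp
  · simp
  · simp
  · rw [mul_zero, zero_add]
    congr 1
    ext j
    split_ifs <;> simp

/-- Conjugating the controlled sign by the addition of a bit yields a phase on basis states: on the
states with clean qubit `0`, the sign is `-1` where both `s` and `t` hold. -/
lemma addBit_mul_controlledSign_mul_addBit [Fintype J] [DecidableEq J] (s t : J → Bool) :
    addBit s * controlledSign t * addBit s
      = Matrix.fromBlocks (Matrix.diagonal fun j => if s j && t j then -1 else 1) 0 0
        (Matrix.diagonal fun j => if !s j && t j then -1 else 1) := by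
  simp only [addBit, controlledSign, Matrix.fromBlocks_multiply, Matrix.diagonal_mul_diagonal,
    mul_zero, mul_one, zero_add, add_zero, Matrix.diagonal_add]
  rw [← Matrix.diagonal_zero]
  congr 2 <;> ext j <;> cases s j <;> cases t j <;> simp

/-- Conjugation by `flipUnlessUniform` turns the projection onto clean qubit `0` into a projection
whose eigenvectors of eigenvalue `1` with clean qubit `0` are the multiples of `u`. -/
lemma flipUnlessUniform_mul_clean_mul_flipUnlessUniform [Fintype J] [DecidableEq J] [Nonempty J] :
    flipUnlessUniform J * Matrix.fromBlocks 1 0 0 0 * flipUnlessUniform J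
      = Matrix.fromBlocks (uniformProjection J) 0 0 (1 - uniformProjection J) := by
  have h := uniformProjection_mul_self (J := J)
  rw [flipUnlessUniform, Matrix.fromBlocks_multiply, Matrix.fromBlocks_multiply]
  simp only [mul_zero, zero_mul, mul_one, add_zero]
  congr 1 <;> simp only [sub_mul, mul_sub, h, one_mul, mul_one] <;> abel

lemma trace_uniformProjection_phase [Fintype J] [DecidableEq J] (g : J → ℂ) :
    (uniformProjection J * (Matrix.diagonal g * uniformProjection J * Matrix.diagonal g)).trace
      = ((∑ j, g j) / Fintype.card J) ^ 2 := by
  simp only [Matrix.trace, Matrix.diag_apply, Matrix.mul_apply (M := uniformProjection J),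
    Matrix.mul_diagonal, Matrix.diagonal_mul]
  simp only [uniformProjection, Matrix.of_apply]
  rw [div_eq_mul_inv, mul_pow, sq (∑ j, g j), Finset.sum_mul_sum, Finset.sum_mul]
  refine Finset.sum_congr rfl fun i _ => ?_
  rw [Finset.sum_mul]
  exact Finset.sum_congr rfl fun j _ => by ring

/-- The states of `r + 1` qubits, split according to the clean qubit `0`. -/
def cleanSplit (r : ℕ) : (Fin (r + 1) → Bool) ≃ (Fin r → Bool) ⊕ (Fin r → Bool) :=
  (Fin.consEquiv fun _ => Bool).symm.trans (Equiv.boolProdEquivSum _)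

lemma oneCleanQubitState_eq (r : ℕ) :
    oneCleanQubitState r
      = (((1 : ℂ) / 2 ^ r) • Matrix.fromBlocks (1 : Matrix (Fin r → Bool) (Fin r → Bool) ℂ)
          0 0 0).submatrix (cleanSplit r) (cleanSplit r) := by
  have h : Matrix.fromBlocks (1 : Matrix (Fin r → Bool) (Fin r → Bool) ℂ) 0 0
      (0 : Matrix (Fin r → Bool) (Fin r → Bool) ℂ)
      = Matrix.diagonal (Sum.elim 1 0) := by
    rw [← Matrix.fromBlocks_diagonal]
    simp
  rw [h, ← Matrix.diagonal_smul, Matrix.submatrix_diagonal_equiv, oneCleanQubitState]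
  congr 1
  ext b
  cases h : b 0 <;> simp [cleanSplit, Fin.consEquiv, Equiv.boolProdEquivSum, h]

/-- The protocol that tests whether the signs `(-1) ^ (s x j * t y j)`, for `j` in a register of `r`
qubits, cancel. Alice's first operation spreads the state evenly over a space that contains only
multiples of `|u⟩` among the states with clean qubit `0`; the bits of Alice and Bob then produce the
signs, and the final projection is again onto `|u⟩` with clean qubit `0`. -/
noncomputable def phaseTest {X Y : Type} (r : ℕ) (s : X → (Fin r → Bool) → Bool)
    (t : Y → (Fin r → Bool) → Bool) : QuantumProtocol X Y (Fin (r + 1)) Finset.univ :=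
  roundTripProtocol (cleanSplit r)
    (fun x => ⟨addBit (s x), mem_unitaryGroup_of_involution (addBit_conjTranspose _)
        (addBit_mul_self _)⟩ *
      ⟨flipUnlessUniform _, mem_unitaryGroup_of_involution flipUnlessUniform_conjTranspose
        flipUnlessUniform_mul_self⟩)
    (fun x => ⟨addBit (s x), mem_unitaryGroup_of_involution (addBit_conjTranspose _)
      (addBit_mul_self _)⟩)
    (fun y => ⟨controlledSign (t y), mem_unitaryGroup_of_involution
      (controlledSign_conjTranspose _) (controlledSign_mul_self _)⟩)
    (Matrix.fromBlocks (uniformProjection _) 0 0 0)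
    (by simp [Matrix.IsHermitian, Matrix.fromBlocks_conjTranspose,
      uniformProjection_conjTranspose])
    (by simp [Matrix.fromBlocks_multiply, uniformProjection_mul_self])

lemma phaseTest_communication {X Y : Type} (r : ℕ) (s : X → (Fin r → Bool) → Bool)
    (t : Y → (Fin r → Bool) → Bool) : (phaseTest r s t).communication = 2 * (r + 1) := by
  refine (roundTripProtocol_communication ..).trans ?_
  rw [Fintype.card_fin]

lemma phaseTest_acceptProb {X Y : Type} (r : ℕ) (s : X → (Fin r → Bool) → Bool)
    (t : Y → (Fin r → Bool) → Bool) (x : X) (y : Y) :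
    (phaseTest r s t).acceptProb x y (oneCleanQubitState r)
      = 1 / 2 ^ r * ((∑ j, if s x j && t y j then (-1 : ℝ) else 1) / 2 ^ r) ^ 2 := by
  rw [oneCleanQubitState_eq]
  refine (roundTripProtocol_acceptProb ..).trans ?_
  simp only [Submonoid.coe_mul, Matrix.conjTranspose_mul, addBit_conjTranspose,
    controlledSign_conjTranspose, flipUnlessUniform_conjTranspose]
  have hassoc : ∀ A D W Z : Matrix ((Fin r → Bool) ⊕ (Fin r → Bool))
      ((Fin r → Bool) ⊕ (Fin r → Bool)) ℂ,
      A * (D * (A * W * Z * (W * A)) * D) * A = A * D * A * (W * Z * W) * (A * D * A) := by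
    intros; simp only [Matrix.mul_assoc]
  rw [hassoc, mul_smul_comm, smul_mul_assoc, flipUnlessUniform_mul_clean_mul_flipUnlessUniform,
    addBit_mul_controlledSign_mul_addBit]
  simp only [Matrix.fromBlocks_multiply, Matrix.fromBlocks_smul, mul_smul_comm, smul_mul_assoc,
    mul_zero, zero_mul, add_zero, zero_add, smul_zero]
  have htrace : ∀ M : Matrix (Fin r → Bool) (Fin r → Bool) ℂ,
      (Matrix.fromBlocks M 0 0 (0 : Matrix (Fin r → Bool) (Fin r → Bool) ℂ)).trace = M.trace := by
    intro M
    simp [Matrix.trace, Fintype.sum_sum_type]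
  rw [htrace, Matrix.trace_smul]
  rw [trace_uniformProjection_phase]
  have hcard : Fintype.card (Fin r → Bool) = 2 ^ r := by simp
  rw [hcard, ← Complex.ofReal_re (1 / 2 ^ r * _)]
  congr 1
  push_cast
  simp only [smul_eq_mul, apply_ite (Complex.ofReal), Complex.ofReal_neg, Complex.ofReal_one]

end PhaseTest

/-! ### The protocol for the middle function -/

/-- The number of common ones of `x` and `y`. -/
def overlap {n : ℕ} (x y : Fin n → Bool) : ℕ := ∑ i, (x i).toNat * (y i).toNat

/-- The test whether the overlap of `x` and `y` differs from `n / 2`, rounded down. -/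
def overlapTest {n : ℕ} (x y : Fin n → Bool) : Bool := decide (overlap x y ≠ n / 2)

lemma overlapTest_eq_true {n : ℕ} {x y : Fin n → Bool} :
    overlapTest x y = true ↔ overlap x y ≠ n / 2 := decide_eq_true_iff

lemma overlapTest_eq_false {n : ℕ} {x y : Fin n → Bool} :
    overlapTest x y = false ↔ overlap x y = n / 2 := by
  simp [overlapTest]

lemma overlapTest_eq_middle {n : ℕ} (hn : Even n) : overlapTest = middle n := by
  obtain ⟨m, rfl⟩ := hn
  funext x y
  rw [overlapTest, middle, show (m + m) / 2 = m by omega, decide_eq_decide, Nat.cast_add m m,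
    show ((m : ℚ) + m) / 2 = m by ring, ← overlap, Ne, Ne, Nat.cast_inj]

lemma half_le_two_pow_log (n : ℕ) : n / 2 ≤ 2 ^ Nat.log 2 n ∧ n - n / 2 ≤ 2 ^ Nat.log 2 n := by
  have h := Nat.lt_pow_succ_log_self (b := 2) (by norm_num) n
  rw [pow_succ] at h
  omega

/-- The register of `Nat.log 2 n + 1` qubits has one basis state for each of the `n` coordinates; the
others are divided such that the signs of `padInput` cancel exactly at overlap `n / 2`. -/
noncomputable def registerEquiv (n : ℕ) :
    Fin n ⊕ (Fin (2 ^ Nat.log 2 n - n / 2) ⊕ Fin (2 ^ Nat.log 2 n - (n - n / 2)))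
      ≃ (Fin (Nat.log 2 n + 1) → Bool) :=
  Fintype.equivOfCardEq (by
    have h := half_le_two_pow_log n
    simp only [Fintype.card_sum, Fintype.card_fin, Fintype.card_pi, Fintype.card_bool,
      Finset.prod_const, Finset.card_univ, pow_succ]
    omega)

/-- The input `x`, padded with constant bits to a function on the basis states of the register. -/
noncomputable def padInput {n : ℕ} (x : Fin n → Bool) (j : Fin (Nat.log 2 n + 1) → Bool) : Bool :=
  Sum.elim x (Sum.elim (fun _ => true) (fun _ => false)) ((registerEquiv n).symm j)

lemma sum_sign_padInput {n : ℕ} (x y : Fin n → Bool) :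
    ∑ j, (if padInput x j && padInput y j then (-1 : ℝ) else 1)
      = 2 * (((n / 2 : ℕ) : ℝ) - overlap x y) := by
  have h1 : ∀ a b : Bool, (if a && b then (-1 : ℝ) else 1)
      = 1 - 2 * ((a.toNat * b.toNat : ℕ) : ℝ) := by
    intro a b
    cases a <;> cases b <;> norm_num
  obtain ⟨hg, hh⟩ := half_le_two_pow_log n
  simp only [h1]
  rw [← Equiv.sum_comp (registerEquiv n)]
  simp only [padInput, Equiv.symm_apply_apply, Fintype.sum_sum_type, Sum.elim_inl, Sum.elim_inr,
    Finset.sum_sub_distrib, ← Finset.mul_sum, ← Nat.cast_sum]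
  simp only [Finset.sum_const, Finset.card_univ, Fintype.card_fin, smul_eq_mul, nsmul_eq_mul,
    Bool.toNat_true, Bool.toNat_false, mul_one, one_mul, mul_zero, add_zero,
    Nat.cast_add]
  rw [Nat.cast_sub hg, Nat.cast_sub hh, Nat.cast_sub (Nat.div_le_self n 2), overlap]
  ring

/-- The one-clean-qubit protocol that tests whether the overlap of the inputs is `n / 2`. -/
noncomputable def middleProtocol (n : ℕ) : OneCleanQubitProtocol (Fin n → Bool) (Fin n → Bool) where
  mixed := Nat.log 2 n + 1
  aliceStart := Finset.univ
  protocol := phaseTest (Nat.log 2 n + 1) padInput padInput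

lemma middleProtocol_communication (n : ℕ) :
    (middleProtocol n).communication = 2 * (Nat.log 2 n + 1 + 1) :=
  phaseTest_communication _ _ _

lemma middleProtocol_acceptProb (n : ℕ) (x y : Fin n → Bool) :
    (middleProtocol n).acceptProb x y
      = 4 * (((n / 2 : ℕ) : ℝ) - overlap x y) ^ 2 / (2 ^ (Nat.log 2 n + 1)) ^ 3 := by
  refine (phaseTest_acceptProb (Nat.log 2 n + 1) padInput padInput x y).trans ?_
  rw [sum_sign_padInput]
  field_simp
  ring

lemma middleProtocol_communication_le {n : ℕ} (hn : 2 ≤ n) :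
    ((middleProtocol n).communication : ℝ) ≤ 6 / Real.log 2 * Real.log n := by
  have h2 : 0 < Real.log 2 := Real.log_pos (by norm_num)
  have h1 : (Nat.log 2 n : ℝ) ≤ Real.log n / Real.log 2 := by
    have := Real.natLog_le_logb n 2
    rwa [Real.logb] at this
  have h3 : 1 ≤ Real.log n / Real.log 2 := by
    rw [one_le_div h2]
    exact Real.log_le_log (by norm_num) (by exact_mod_cast hn)
  rw [middleProtocol_communication]
  push_cast
  have : 6 / Real.log 2 * Real.log n = 6 * (Real.log n / Real.log 2) := by ring
  linarith

/-! ### Simulation by sending the whole input -/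

/-- Alice sends the `n` bits `g i x`, and Bob answers with a bit that depends on all that he
knows. -/
lemma ProtocolTree.exists_eval_eq {X Y : Type} (n : ℕ) (g : Fin n → X → Bool)
    (F : (Fin n → Bool) → Y → Bool) :
    ∃ t : ProtocolTree X Y, t.depth ≤ n + 1 ∧ ∀ x y, t.eval x y = F (fun i => g i x) y := by
  induction n with
  | zero =>
    refine ⟨.bob (F Fin.elim0) (.output false) (.output true), by simp [depth], fun x y => ?_⟩
    have : (fun i => g i x) = Fin.elim0 := funext fun i => i.elim0
    simp only [eval, this]
    cases F Fin.elim0 y <;> rfl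
  | succ n ih =>
    obtain ⟨l, hl, hl'⟩ := ih (fun i => g i.succ) fun b => F (Fin.cons false b)
    obtain ⟨r, hr, hr'⟩ := ih (fun i => g i.succ) fun b => F (Fin.cons true b)
    refine ⟨.alice (g 0) l r, by simp only [depth]; omega, fun x y => ?_⟩
    have : ∀ o, g 0 x = o → Fin.cons o (fun i : Fin n => g i.succ x) = fun i => g i x := by
      rintro o rfl
      exact Fin.cons_self_tail fun i => g i x
    simp only [eval, hl', hr']
    cases h : g 0 x
    · simp [this _ h]
    · simp [this _ h]

lemma RandomizedProtocol.exists_acceptProb_eq {Y : Type} (n D : ℕ) (hD : 0 < D)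
    (w : (Fin n → Bool) → Y → ℕ) (hw : ∀ x y, w x y ≤ D) :
    ∃ R : RandomizedProtocol (Fin n → Bool) Y, R.CommunicationAtMost (n + 1) ∧
      ∀ x y, R.acceptProb x y = w x y / D := by
  have : NeZero D := ⟨hD.ne'⟩
  choose τ hτ hτ' using fun u : Fin D => ProtocolTree.exists_eval_eq (Y := Y) n
    (fun i (x : Fin n → Bool) => x i) fun x y => decide (u.val < w x y)
  refine ⟨(PMF.uniformOfFintype (Fin D)).map τ, ?_, fun x y => ?_⟩
  · intro t ht
    obtain ⟨u, -, rfl⟩ := (PMF.mem_support_map_iff _ _ _).1 ht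
    exact hτ u
  · rw [RandomizedProtocol.acceptProb, PMF.map_comp, PMF.map_apply, tsum_fintype]
    simp only [Function.comp, hτ', PMF.uniformOfFintype_apply, eq_comm (a := true),
      decide_eq_true_eq, Fintype.card_fin]
    rw [← Finset.sum_filter, Finset.sum_const, nsmul_eq_mul, ENNReal.toReal_mul,
      ENNReal.toReal_natCast, ENNReal.toReal_inv, ENNReal.toReal_natCast,
      Fin.card_filter_val_lt, min_eq_right (hw x y), div_eq_mul_inv]

lemma overlap_le {n : ℕ} (x y : Fin n → Bool) : overlap x y ≤ n := by
  have : ∀ i ∈ Finset.univ, (x i).toNat * (y i).toNat ≤ 1 := fun i _ => by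
    cases x i <;> cases y i <;> simp
  simpa [overlap] using Finset.sum_le_card_nsmul Finset.univ _ 1 this

lemma exists_simulation_middleProtocol (n : ℕ) :
    ∃ R : RandomizedProtocol (Fin n → Bool) (Fin n → Bool), R.CommunicationAtMost (n + 1) ∧
      ∀ x y, R.acceptProb x y = (middleProtocol n).acceptProb x y := by
  obtain ⟨R, hR, hR'⟩ := RandomizedProtocol.exists_acceptProb_eq n
    ((2 ^ (Nat.log 2 n + 1)) ^ 3) (by positivity)
    (fun x y : Fin n → Bool => 4 * (((n / 2 : ℕ) : ℤ) - overlap x y).natAbs ^ 2) (by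
      intro x y
      obtain ⟨hg, hh⟩ := half_le_two_pow_log n
      have ho := overlap_le x y
      have h1 : (((n / 2 : ℕ) : ℤ) - overlap x y).natAbs ≤ 2 ^ Nat.log 2 n := by omega
      have h2 : 1 ≤ 2 ^ (Nat.log 2 n + 1) := Nat.one_le_two_pow
      calc 4 * (((n / 2 : ℕ) : ℤ) - overlap x y).natAbs ^ 2
          ≤ 4 * (2 ^ Nat.log 2 n) ^ 2 := by gcongr
        _ = (2 ^ (Nat.log 2 n + 1)) ^ 2 := by rw [pow_succ 2, mul_pow]; ring
        _ ≤ _ := Nat.pow_le_pow_right h2 (by norm_num))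
  refine ⟨R, hR, fun x y => ?_⟩
  rw [hR', middleProtocol_acceptProb]
  have : ((((n / 2 : ℕ) : ℤ) - overlap x y).natAbs : ℝ) ^ 2
      = (((n / 2 : ℕ) : ℝ) - overlap x y) ^ 2 := by
    rw [Nat.cast_natAbs, Int.cast_abs, sq_abs]
    push_cast
    rfl
  push_cast at this ⊢
  rw [this]

/-! ### The lower bound for the middle function -/

/-- The subset `a` of the last `M` coordinates, preceded by `m` ones. -/
def onesThenSet {n m M : ℕ} (h : m + M = n) (a : Finset (Fin M)) (i : Fin n) : Bool :=
  Sum.elim (fun _ => true) (fun j => decide (j ∈ a))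
    ((finSumFinEquiv.trans (finCongr h)).symm i)

lemma overlap_onesThenSet {n m M : ℕ} (h : m + M = n) (a b : Finset (Fin M)) :
    overlap (onesThenSet h a) (onesThenSet h b) = m + (a ∩ b).card := by
  rw [overlap, ← Equiv.sum_comp (finSumFinEquiv.trans (finCongr h)), Fintype.sum_sum_type]
  simp only [onesThenSet, Equiv.symm_apply_apply, Sum.elim_inl, Sum.elim_inr]
  congr 1
  · simp
  · rw [← Finset.filter_mem_eq_inter, Finset.card_filter, ← Finset.sum_filter_add_sum_filter_not
      Finset.univ (fun i => i ∈ a)]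
    rw [Finset.filter_mem_eq_inter, Finset.univ_inter]
    rw [Finset.sum_eq_zero (s := Finset.univ.filter fun i => i ∉ a), add_zero]
    · refine Finset.sum_congr rfl fun i hi => ?_
      by_cases hb : i ∈ b <;> simp [hi, hb]
    · intro i hi
      simp [(Finset.mem_filter.1 hi).2]

/-- A protocol that simulates the test for overlap `n / 2` distinguishes disjoint from uniquely
intersecting subsets of `n - (n / 2 - 1)` coordinates, the other coordinates being fixed to one. -/
lemma RandomizedProtocol.le_of_simulates_overlap {n : ℕ} (hn : 2 ≤ n)
    (R : RandomizedProtocol (Fin n → Bool) (Fin n → Bool)) {d : ℕ} (hd : R.CommunicationAtMost d)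
    {α ε : ℝ} (hε : 0 ≤ ε)
    (hR : R.Simulates overlapTest α 0 ε) (q : ℕ) :
    8 * q * (α - ε) ≤ 16 * (((n - (n / 2 - 1) : ℕ) : ℝ) * ε)
      + 2 ^ d * (2 * ((n - (n / 2 - 1) : ℕ) : ℝ) * (81 / 128) ^ q
        + 16 * q * 2 ^ (16 * q) * (7 / 8) ^ (n - (n / 2 - 1))) := by
  have h : (n / 2 - 1) + (n - (n / 2 - 1)) = n := by omega
  have key := R.le_of_separates_disjoint_unique hd (onesThenSet h) (onesThenSet h)
    (γ := α - ε) hε ?_ ?_ q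
  · simpa only [Fintype.card_fin] using key
  · intro a b hab
    refine hR.1 _ _ ?_
    rw [overlapTest_eq_true, overlap_onesThenSet, Finset.disjoint_iff_inter_eq_empty.1 hab,
      Finset.card_empty]
    omega
  · intro a b i hab
    have := hR.2 (onesThenSet h a) (onesThenSet h b) (by
      rw [overlapTest_eq_false, overlap_onesThenSet, hab, Finset.card_singleton]
      omega)
    simpa using this

/-- Here `N ^ 3 / 4` is the inverse of the gap of the quantum protocol and `M` the number of free
coordinates. On the left side of the hypothesis the gap dominates the error, so `2 ^ d` must make up
for the exponentially small factor on the right. -/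
lemma eventually_le_of_tradeoff :
    ∀ᶠ n : ℕ in atTop, ∀ d M N q : ℕ, n ≤ 2 * M → M ≤ n → q = M / 160 → 0 < N → N ≤ 2 * n →
      8 * q * (4 / (N : ℝ) ^ 3 - 1 / (n : ℝ) ^ 4) ≤ 16 * ((M : ℝ) * (1 / (n : ℝ) ^ 4))
        + 2 ^ d * (2 * (M : ℝ) * (81 / 128) ^ q + 16 * q * 2 ^ (16 * q) * (7 / 8) ^ M) →
      (1 / 1280 : ℝ) * n ≤ d := by
  have hlim := (tendsto_pow_const_mul_const_pow_of_abs_lt_one 10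
    (r := (6561 / 8192 : ℝ)) (by rw [abs_lt]; norm_num)).const_mul ((18 * 640 ^ 5 : ℝ) ^ 2)
  rw [mul_zero] at hlim
  obtain ⟨q₀, hq₀⟩ := eventually_atTop.1 (hlim.eventually (gt_mem_nhds (zero_lt_one' ℝ)))
  refine eventually_atTop.2 ⟨1283 + 640 * q₀, fun n hn d M N q hM hM' hq hN hN' h => ?_⟩
  have hqn : n ≤ 640 * q := by omega
  have hMq : M ≤ 320 * q := by omega
  have hqM : 160 * q ≤ M := by omega
  have hq1 : 1 ≤ q := by omega
  have hn0 : (0 : ℝ) < n := by exact_mod_cast (show 0 < n by omega)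
  have hnR : (1283 : ℝ) ≤ n := by exact_mod_cast (show 1283 ≤ n by omega)
  have hqR : (1 : ℝ) ≤ q := by exact_mod_cast hq1
  have hMqR : (M : ℝ) ≤ 320 * q := by exact_mod_cast hMq
  have hMnR : (M : ℝ) ≤ n := by exact_mod_cast hM'
  have hqnR : (q : ℝ) ≤ n := by exact_mod_cast (show q ≤ n by omega)
  have hN0 : (0 : ℝ) < N := by exact_mod_cast hN
  have hNR : (N : ℝ) ≤ 2 * n := by exact_mod_cast hN'
  set δ : ℝ := (81 / 128) ^ q with hδ
  have hδ0 : 0 < δ := by positivity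
  have hα : 1 / (2 * (n : ℝ) ^ 3) ≤ 4 / (N : ℝ) ^ 3 := by
    rw [div_le_div_iff₀ (by positivity) (by positivity)]
    have := pow_le_pow_left₀ hN0.le hNR 3
    nlinarith
  have htail : (2 : ℝ) ^ (16 * q) * (7 / 8) ^ M ≤ δ := by
    have h1 : (7 / 8 : ℝ) ^ M ≤ (7 / 8) ^ (160 * q) :=
      pow_le_pow_of_le_one (by norm_num) (by norm_num) hqM
    calc (2 : ℝ) ^ (16 * q) * (7 / 8) ^ M ≤ 2 ^ (16 * q) * (7 / 8) ^ (160 * q) := by gcongr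
      _ = (2 ^ 16 * (7 / 8) ^ 160) ^ q := by rw [pow_mul, pow_mul, ← mul_pow]
      _ ≤ δ := pow_le_pow_left₀ (by positivity) (by norm_num) q
  have herr : 2 * (M : ℝ) * δ + 16 * q * 2 ^ (16 * q) * (7 / 8) ^ M ≤ 18 * n * δ := by
    have h1 : 16 * (q : ℝ) * 2 ^ (16 * q) * (7 / 8) ^ M ≤ 16 * n * δ := by
      rw [mul_assoc (16 * (q : ℝ))]
      gcongr
    have h2 : 2 * (M : ℝ) * δ ≤ 2 * n * δ := by gcongr
    linarith
  -- After multiplication by `n ^ 4` the left side of `h` is at least `4 * q * n - 8 * q`, and the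
  -- error term on the right is at most `5120 * q`.
  have hone : 1 ≤ 2 ^ d * (18 * (n : ℝ) ^ 5 * δ) := by
    have h1 : 8 * (q : ℝ) * (1 / (2 * (n : ℝ) ^ 3) - 1 / (n : ℝ) ^ 4)
        ≤ 16 * (320 * q * (1 / (n : ℝ) ^ 4)) + 2 ^ d * (18 * n * δ) := by
      calc 8 * (q : ℝ) * (1 / (2 * (n : ℝ) ^ 3) - 1 / (n : ℝ) ^ 4)
          ≤ 8 * q * (4 / (N : ℝ) ^ 3 - 1 / (n : ℝ) ^ 4) := by gcongr
        _ ≤ _ := h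
        _ ≤ _ := by gcongr
    have h2 := mul_le_mul_of_nonneg_right h1 (show (0 : ℝ) ≤ (n : ℝ) ^ 4 by positivity)
    have h3 : 8 * (q : ℝ) * (1 / (2 * (n : ℝ) ^ 3) - 1 / (n : ℝ) ^ 4) * (n : ℝ) ^ 4
        = 4 * q * n - 8 * q := by
      field_simp
      ring
    have h4 : (16 * (320 * (q : ℝ) * (1 / (n : ℝ) ^ 4)) + 2 ^ d * (18 * n * δ)) * (n : ℝ) ^ 4
        = 5120 * q + 2 ^ d * (18 * (n : ℝ) ^ 5 * δ) := by
      field_simp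
      ring
    rw [h3, h4] at h2
    nlinarith
  -- If `2 * d < q`, squaring `hone` gives `1 ≤ C ^ 2 * q ^ 10 * (2 * (81 / 128) ^ 2) ^ q`.
  have hqd : q ≤ 2 * d := by
    by_contra hcon
    have hdq : (2 : ℝ) ^ (2 * d) ≤ 2 ^ q := pow_le_pow_right₀ (by norm_num) (by omega)
    have hn5 : (n : ℝ) ^ 5 ≤ 640 ^ 5 * (q : ℝ) ^ 5 := by
      rw [← mul_pow]
      exact pow_le_pow_left₀ hn0.le (by exact_mod_cast hqn) 5
    have h1 : 1 ≤ 2 ^ d * (18 * (640 ^ 5 * (q : ℝ) ^ 5) * δ) :=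
      hone.trans (by gcongr)
    have h2 : 1 ≤ (2 ^ d * (18 * (640 ^ 5 * (q : ℝ) ^ 5) * δ)) ^ 2 := one_le_pow₀ h1
    have h3 : (2 ^ d * (18 * (640 ^ 5 * (q : ℝ) ^ 5) * δ)) ^ 2
        = 2 ^ (2 * d) * ((18 * 640 ^ 5 : ℝ) ^ 2 * ((q : ℝ) ^ 10 * δ ^ 2)) := by ring
    have h4 : (2 : ℝ) ^ q * δ ^ 2 = (6561 / 8192) ^ q := by
      rw [hδ, ← pow_mul, mul_comm q 2, pow_mul, ← mul_pow]
      norm_num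
    have h5 : 2 ^ (2 * d) * ((18 * 640 ^ 5 : ℝ) ^ 2 * ((q : ℝ) ^ 10 * δ ^ 2))
        ≤ 2 ^ q * ((18 * 640 ^ 5 : ℝ) ^ 2 * ((q : ℝ) ^ 10 * δ ^ 2)) := by gcongr
    have h6 : 2 ^ q * ((18 * 640 ^ 5 : ℝ) ^ 2 * ((q : ℝ) ^ 10 * δ ^ 2))
        = (18 * 640 ^ 5 : ℝ) ^ 2 * ((q : ℝ) ^ 10 * (6561 / 8192) ^ q) := by
      rw [← h4]; ring
    have h7 := hq₀ q (by omega)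
    rw [h3] at h2
    rw [h6] at h5
    linarith
  have : (n : ℝ) ≤ 1280 * d := by exact_mod_cast (show n ≤ 1280 * d by omega)
  linarith

theorem mainTheorem1 :
    ∃ f : (n : ℕ) → (Fin n → Bool) → (Fin n → Bool) → Bool,
      (∀ n, Even n → f n = middle n) ∧
      ∃ P : (n : ℕ) → OneCleanQubitProtocol (Fin n → Bool) (Fin n → Bool),
        -- the quantum communication is `O(log n)`
        (∃ K : ℝ, ∀ n : ℕ, 2 ≤ n → ((P n).communication : ℝ) ≤ K * Real.log n) ∧
        ∃ α β : ℕ → ℝ,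
          (∀ n, β n < α n ∧ AcceptsWith (P n).acceptProb (f n) (α n) (β n)) ∧
          ∃ c C : ℝ, 0 < c ∧ ∀ᶠ n : ℕ in atTop,
            -- every simulation needs `Ω(n)` bits
            (∀ (R : RandomizedProtocol (Fin n → Bool) (Fin n → Bool)) (d : ℕ),
              R.CommunicationAtMost d → R.Simulates (f n) (α n) (β n) (1 / (n : ℝ) ^ 4) →
              c * n ≤ d) ∧
            -- and `O(n)` bits suffice, even for approximating all acceptance probabilities
            (∃ (R : RandomizedProtocol (Fin n → Bool) (Fin n → Bool)) (d : ℕ),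
              R.CommunicationAtMost d ∧ (d : ℝ) ≤ C * n ∧
              R.Simulates (f n) (α n) (β n) (1 / (n : ℝ) ^ 4) ∧
              ∀ x y, |R.acceptProb x y - (P n).acceptProb x y| ≤ 1 / (n : ℝ) ^ 4) := by
  have haccepts : ∀ n, AcceptsWith (middleProtocol n).acceptProb
      overlapTest (4 / (2 ^ (Nat.log 2 n + 1)) ^ 3) 0 := by
    intro n
    refine ⟨fun x y hxy => ?_, fun x y hxy => ?_⟩
    · rw [middleProtocol_acceptProb]
      have h0 : ((n / 2 : ℕ) : ℤ) - overlap x y ≠ 0 := by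
        have := overlapTest_eq_true.1 hxy
        omega
      have h1 : (1 : ℝ) ≤ (((n / 2 : ℕ) : ℝ) - overlap x y) ^ 2 := by
        have h2 : 0 < (((n / 2 : ℕ) : ℤ) - overlap x y) ^ 2 := by positivity
        have h3 : (1 : ℤ) ≤ (((n / 2 : ℕ) : ℤ) - overlap x y) ^ 2 := h2
        exact_mod_cast h3
      gcongr
      linarith
    · rw [middleProtocol_acceptProb]
      simp [overlapTest_eq_false.1 hxy]
  refine ⟨fun n => overlapTest, fun n => overlapTest_eq_middle, middleProtocol,
    ⟨6 / Real.log 2, fun n hn => middleProtocol_communication_le hn⟩,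
    fun n => 4 / (2 ^ (Nat.log 2 n + 1)) ^ 3, fun _ => 0,
    fun n => ⟨by positivity, haccepts n⟩, 1 / 1280, 2, by norm_num, ?_⟩
  · filter_upwards [eventually_le_of_tradeoff, eventually_ge_atTop 2] with n htrade hn
    refine ⟨fun R d hd hR => ?_, ?_⟩
    · refine htrade d (n - (n / 2 - 1)) (2 ^ (Nat.log 2 n + 1)) _ (by omega) (by omega) rfl
        (by positivity) ?_ ?_
      · have := Nat.pow_log_le_self 2 (show n ≠ 0 by omega)
        rw [pow_succ]
        omega
      · push_cast
        exact R.le_of_simulates_overlap hn hd (by positivity) hR _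
    · obtain ⟨R, hR, hR'⟩ := exists_simulation_middleProtocol n
      have hε : (0 : ℝ) ≤ 1 / (n : ℝ) ^ 4 := by positivity
      refine ⟨R, n + 1, hR, ?_, ⟨fun x y hxy => ?_, fun x y hxy => ?_⟩, fun x y => ?_⟩
      · have : (2 : ℝ) ≤ n := by exact_mod_cast hn
        push_cast
        linarith
      · rw [hR']
        linarith [(haccepts n).1 x y hxy]
      · rw [hR']
        linarith [(haccepts n).2 x y hxy]
      · rw [hR', sub_self, abs_zero]
        exact hε
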